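/- Let $G$ be a (finite-dimensional, real, smooth) Lie group, for instance a connected semisimple one, with Lie algebra $\mathfrak g$ and left Maurer--Cartan form $\mu\in\Omega^1(G,\mathfrak g)$ (left-invariant, the identity at $1_G$). Let $X_G$ be the manifold $G$ with the action $(g,h)\cdot x=gxh^{-1}$ of $G\times G$, and let $P_G$ be the principal $G$-bundle $\pi: G\times G\to X_G$, $\pi(g,h)=gh^{-1}$, with $G$ acting on $G\times G$ by diagonal right multiplication. Let $p_1,p_2:G\times G\to G$ be the projections; $\Theta_L=p_2^*\mu$ and $\Theta_R=p_1^*\mu$ are principal connections on $P_G$ (left and right parallelism). For $k\ge 1$ let $\mathrm{Sym}^k_{\rm inv}(\mathfrak g^\vee)$ be the space of $\mathrm{Ad}(G)$-invariant $\mathbb C$-valued homogeneous polynomials of degree $k$ on $\mathfrak g$, identified with symmetric $\mathbb R$-multilinear forms $\mathfrak g^k\to\mathbb C$. For connections $\Theta_0,\Theta_1$ on a principal $G$-bundle $P\to M$, put $\Theta_t=(1-t)\Theta_0+t\Theta_1$ and $R_t=d\Theta_t+\tfrac12[\Theta_t,\Theta_t]$; the Chern--Simons form $CS_f(\Theta_0,\Theta_1)$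 is the $(2k-1)$-form on $M$ whose pull-back to $P$ is $k\int_0^1 f(\Theta_1-\Theta_0,R_t,\dots,R_t)\,dt$. Put $\tau(f)=f(\mu,[\mu,\mu],\dots,[\mu,\mu])$, a $(2k-1)$-form on $G$. Theorem. For every $k\ge 1$ and every $f\in \mathrm{Sym}^k_{\rm inv}(\mathfrak g^\vee)$, there is exactly one $(2k-1)$-form $CS_f(\Theta_L,\Theta_R)$ on $X_G=G$ with the above property, and $$CS_f(\Theta_L,\Theta_R)=\frac{(-1)^{k-1}\,k!\,(k-1)!}{2^{k-1}(2k-1)!}\;\tau(f).$$ Equivalently, if $\iota(x)=x^{-1}$ (that is, if $(G\times G)/\Delta(G)$ is identified with $G$ through $(g,h)\mapsto hg^{-1}$ instead of $gh^{-1}$), $$\iota^*CS_f(\Theta_L,\Theta_R)=\frac{(-1)^{k}\,k!\,(k-1)!}{2^{k-1}(2k-1)!}\;\tau(f).$$ -/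

import Mathlib

open scoped Manifold ContDiff

noncomputable section

namespace ChernSimons

/-- A finite-dimensional real normed space is complete. -/
instance completeOfFiniteDimensional (E : Type*) [NormedAddCommGroup E] [NormedSpace ℝ E]
    [FiniteDimensional ℝ E] : CompleteSpace E :=
  FiniteDimensional.complete ℝ E

section Forms

variable {E : Type*} [NormedAddCommGroup E] [NormedSpace ℝ E]
  {H : Type*} [TopologicalSpace H] (J : ModelWithCorners ℝ E H)
  {P : Type*} [TopologicalSpace P] [ChartedSpace H P]
  {F : Type*} [NormedAddCommGroup F] [NormedSpace ℝ F]

/-- The exterior derivative of a differential form on a manifold. At `p`: express the form in the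
chart at `p`, take the exterior derivative in the model vector space, and pull the result back by
the chart. For `1`-forms the normalization is `dη(X, Y) = X η(Y) - Y η(X) - η([X, Y])`. -/
def mextDeriv {n : ℕ} (η : Π p : P, TangentSpace J p [⋀^Fin n]→L[ℝ] F) (p : P) :
    TangentSpace J p [⋀^Fin (n + 1)]→L[ℝ] F :=
  (extDerivWithin
    (fun y : E => (η ((extChartAt J p).symm y)).compContinuousLinearMap
      (mfderivWithin 𝓘(ℝ, E) J (extChartAt J p).symm (Set.range J) y))
    (Set.range J) (extChartAt J p p)).compContinuousLinearMap
      (mfderiv J 𝓘(ℝ, E) (extChartAt J p) p)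

/-- The exterior derivative of a vector-valued `1`-form, as an alternating bilinear form on each
tangent space. -/
def oneFormExtDeriv (θ : Π p : P, TangentSpace J p →L[ℝ] F) (p : P) :
    TangentSpace J p [⋀^Fin 2]→ₗ[ℝ] F :=
  (mextDeriv J (n := 1)
    (fun q => ContinuousAlternatingMap.ofSubsingleton ℝ (TangentSpace J q) F (0 : Fin 1) (θ q))
    p).toAlternatingMap

end Forms

section LieGroups

variable {E : Type*} [NormedAddCommGroup E] [NormedSpace ℝ E]
  {H : Type*} [TopologicalSpace H] (I : ModelWithCorners ℝ E H)
  {G : Type*} [TopologicalSpace G] [ChartedSpace H G] [Group G]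

/-- The adjoint representation: `Ad g` is the derivative at `1` of `x ↦ g x g⁻¹`. -/
def Ad (g : G) : GroupLieAlgebra I G →L[ℝ] GroupLieAlgebra I G :=
  mfderiv I I (fun x : G => g * x * g⁻¹) 1

/-- The (left) Maurer--Cartan form: the left-invariant `1`-form which is the identity at `1`. -/
def maurerCartan (g : G) : TangentSpace I g →L[ℝ] GroupLieAlgebra I G :=
  mfderiv I I (fun x : G => g⁻¹ * x) g

variable (G) in
/-- `Ad`-invariant `ℂ`-valued homogeneous polynomials of degree `k` on the Lie algebra, identified
with symmetric `ℝ`-multilinear forms in `k` variables. -/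
structure InvariantPolynomial (k : ℕ) where
  toMultilinearMap : MultilinearMap ℝ (fun _ : Fin k => GroupLieAlgebra I G) ℂ
  symmetric : ∀ (σ : Equiv.Perm (Fin k)) (u : Fin k → GroupLieAlgebra I G),
    toMultilinearMap (fun i => u (σ i)) = toMultilinearMap u
  invariant : ∀ (g : G) (u : Fin k → GroupLieAlgebra I G),
    toMultilinearMap (fun i => Ad I g (u i)) = toMultilinearMap u

variable {I}

/-- The slots of `f(α, β, …, β)`: slot `0` is `α(v₀)`, slot `i ≥ 1` is `β(v_{2i-1}, v_{2i})`. -/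
def slot {V L : Type*} [AddCommGroup V] [Module ℝ V] [AddCommGroup L] [Module ℝ L] {k : ℕ}
    (α : V →ₗ[ℝ] L) (β : V [⋀^Fin 2]→ₗ[ℝ] L) (v : Fin (2 * k - 1) → V) (i : Fin k) : L :=
  if i.val = 0 then α (v ⟨2 * i.val, by omega⟩)
  else β ![v ⟨2 * i.val - 1, by omega⟩, v ⟨2 * i.val, by omega⟩]

/-- The only slot in which the variable `v_j` occurs. -/
def slotIndex {k : ℕ} (j : Fin (2 * k - 1)) : Fin k := ⟨(j.val + 1) / 2, by omega⟩

section Slots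

variable {V L : Type*} [AddCommGroup V] [Module ℝ V] [AddCommGroup L] [Module ℝ L] {k : ℕ}
    (α : V →ₗ[ℝ] L) (β : V [⋀^Fin 2]→ₗ[ℝ] L)

theorem slot_update (v : Fin (2 * k - 1) → V) (j : Fin (2 * k - 1)) (x : V) :
    slot α β (Function.update v j x) =
      Function.update (slot α β v) (slotIndex j)
        (slot α β (Function.update v j x) (slotIndex j)) := by
  funext i
  by_cases h : i = slotIndex j
  · subst h; simp
  · rw [Function.update_of_ne h]
    have h' : i.val ≠ (j.val + 1) / 2 := fun e => h (Fin.ext e)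
    unfold slot
    split_ifs with h0
    · rw [Function.update_of_ne (by rintro rfl; simp at h'; omega)]
    · rw [Function.update_of_ne (by rintro rfl; simp at h'; omega),
        Function.update_of_ne (by rintro rfl; simp at h'; omega)]

theorem slot_linear (v : Fin (2 * k - 1) → V) (j : Fin (2 * k - 1)) :
    ∃ T : V →ₗ[ℝ] L, ∀ x, slot α β (Function.update v j x) (slotIndex j) = T x := by
  rcases Nat.even_or_odd' j.val with ⟨m, hm | hm⟩
  · by_cases h0 : m = 0
    · refine ⟨α, fun x => ?_⟩
      have : j = ⟨2 * (slotIndex j).val, by omega⟩ := Fin.ext (by simp [slotIndex]; omega)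
      rw [slot, if_pos (by simp [slotIndex]; omega), ← this, Function.update_self]
    · refine ⟨β.toMultilinearMap.toLinearMap
        ![v ⟨2 * (slotIndex j).val - 1, by omega⟩, 0] 1, fun x => ?_⟩
      have h1 : j = ⟨2 * (slotIndex j).val, by omega⟩ := Fin.ext (by simp [slotIndex]; omega)
      have h2 : (⟨2 * (slotIndex j).val - 1, by omega⟩ : Fin (2 * k - 1)) ≠ j := by
        intro e; have := congrArg Fin.val e; simp [slotIndex] at this; omega
      rw [slot, if_neg (by simp [slotIndex]; omega), ← h1, Function.update_self,
        Function.update_of_ne h2]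
      change _ = β (Function.update _ _ _)
      congr 1
      funext i; fin_cases i <;> simp
  · refine ⟨β.toMultilinearMap.toLinearMap
        ![0, v ⟨2 * (slotIndex j).val, by omega⟩] 0, fun x => ?_⟩
    have h1 : j = ⟨2 * (slotIndex j).val - 1, by omega⟩ := Fin.ext (by simp [slotIndex]; omega)
    have h2 : (⟨2 * (slotIndex j).val, by omega⟩ : Fin (2 * k - 1)) ≠ j := by
      intro e; have := congrArg Fin.val e; simp [slotIndex] at this; omega
    rw [slot, if_neg (by simp [slotIndex]; omega), ← h1, Function.update_self,
      Function.update_of_ne h2]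
    change _ = β (Function.update _ _ _)
    congr 1
    funext i; fin_cases i <;> simp

/-- The multilinear map `(v₀, …, v_{2k-2}) ↦ f(α(v₀), β(v₁, v₂), …, β(v_{2k-3}, v_{2k-2}))`. -/
def slotMultilinear (f : MultilinearMap ℝ (fun _ : Fin k => L) ℂ) :
    MultilinearMap ℝ (fun _ : Fin (2 * k - 1) => V) ℂ :=
  MultilinearMap.mk' (fun v => f (slot α β v))
    (by
      intro v j x y
      obtain ⟨T, hT⟩ := slot_linear α β v j
      rw [slot_update, hT, map_add, f.map_update_add, ← hT, ← hT, ← slot_update, ← slot_update])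
    (by
      intro v j c x
      obtain ⟨T, hT⟩ := slot_linear α β v j
      rw [slot_update, hT, map_smul, f.map_update_smul, ← hT, ← slot_update])

/-- The exterior form `f(α, β, …, β)` of degree `2k - 1` obtained from a `k`-linear form `f`, a
`1`-form `α` and `k - 1` copies of a `2`-form `β`, the exterior product being normalized as
`(ξ ∧ ζ)(v₁, …, v_{p+q}) = (p! q!)⁻¹ ∑_σ sgn(σ) ξ(v_{σ(1)}, …) ζ(…, v_{σ(p+q)})`. -/
def wedgeEval (f : MultilinearMap ℝ (fun _ : Fin k => L) ℂ) : V [⋀^Fin (2 * k - 1)]→ₗ[ℝ] ℂ :=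
  ((1 / 2 : ℂ) ^ (k - 1)) • MultilinearMap.alternatization (slotMultilinear α β f)

end Slots

section Bracket

/-- A smooth Lie group has the regularity under which its tangent space at `1` is a Lie algebra. -/
theorem lieGroup_minSmoothness (I : ModelWithCorners ℝ E H) (G : Type*) [TopologicalSpace G]
    [ChartedSpace H G] [Group G] [LieGroup I ∞ G] : LieGroup I (minSmoothness ℝ 3) G :=
  LieGroup.of_le (n := ∞) (by simpa using ENat.LEInfty.out)

variable [FiniteDimensional ℝ E] [LieGroup I ∞ G]

/-- The bracket `[α, β](v, w) = [α v, β w] - [α w, β v]` of Lie algebra valued `1`-forms. -/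
def bracketForm {V : Type*} [AddCommGroup V] [Module ℝ V]
    (α β : V →ₗ[ℝ] GroupLieAlgebra I G) : V [⋀^Fin 2]→ₗ[ℝ] GroupLieAlgebra I G :=
  { MultilinearMap.mk' (R := ℝ) (fun v : Fin 2 → V => ⁅α (v 0), β (v 1)⁆ - ⁅α (v 1), β (v 0)⁆)
      (by
        intro v i x y
        have := lieGroup_minSmoothness I G
        fin_cases i <;> simp [add_lie, lie_add] <;> abel)
      (by
        intro v i c x
        have := lieGroup_minSmoothness I G
        fin_cases i <;> simp [smul_sub, smul_lie, lie_smul]) with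
    map_eq_zero_of_eq' := by
      intro v i j h hij
      have : v 0 = v 1 := by
        fin_cases i <;> fin_cases j <;> simp_all
      simp [this] }

/-- Cartan--Chevalley--Weil: `τ(f) = f(μ, [μ, μ], …, [μ, μ])`, with `μ` the Maurer--Cartan form. -/
def tau {k : ℕ} (f : InvariantPolynomial I G k) (x : G) :
    TangentSpace I x [⋀^Fin (2 * k - 1)]→ₗ[ℝ] ℂ :=
  wedgeEval (maurerCartan I x).toLinearMap
    (bracketForm (maurerCartan I x).toLinearMap (maurerCartan I x).toLinearMap) f.toMultilinearMap

end Bracket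

end LieGroups

section Bundles

variable {E : Type*} [NormedAddCommGroup E] [NormedSpace ℝ E]
  {H : Type*} [TopologicalSpace H] (I : ModelWithCorners ℝ E H)
  (G : Type*) [TopologicalSpace G] [ChartedSpace H G] [Group G]
  {E₁ : Type*} [NormedAddCommGroup E₁] [NormedSpace ℝ E₁]
  {H₁ : Type*} [TopologicalSpace H₁] (J : ModelWithCorners ℝ E₁ H₁)
  (P : Type*) [TopologicalSpace P] [ChartedSpace H₁ P]
  {E₂ : Type*} [NormedAddCommGroup E₂] [NormedSpace ℝ E₂]
  {H₂ : Type*} [TopologicalSpace H₂] (K : ModelWithCorners ℝ E₂ H₂)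
  (M : Type*) [TopologicalSpace M] [ChartedSpace H₂ M]

/-- A smooth principal `G`-bundle `P → M`: a smooth right action of `G` on `P` preserving the
fibers of a smooth projection, such that over a neighbourhood `U` of each point of `M` there are a
smooth section `s` and a smooth map `c` for which `(x, g) ↦ s(x) g` is a diffeomorphism of
`U × G` onto the part of `P` over `U`, with inverse `p ↦ (proj p, c(p))`. -/
structure PrincipalBundle where
  proj : P → M
  act : P → G → P
  smooth_proj : ContMDiff J K ∞ proj
  smooth_act : ContMDiff (J.prod I) J ∞ (fun q : P × G => act q.1 q.2)
  act_one : ∀ p, act p 1 = p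
  act_mul : ∀ p g h, act p (g * h) = act (act p g) h
  proj_act : ∀ p g, proj (act p g) = proj p
  locally_trivial : ∀ x₀ : M, ∃ U : Set M, IsOpen U ∧ x₀ ∈ U ∧
    ∃ (s : M → P) (c : P → G),
      ContMDiffOn K J ∞ s U ∧ ContMDiffOn J I ∞ c (proj ⁻¹' U) ∧
      (∀ x ∈ U, proj (s x) = x) ∧
      (∀ x ∈ U, ∀ g, c (act (s x) g) = g) ∧
      (∀ p, proj p ∈ U → act (s (proj p)) (c p) = p)

variable {I G J P K M}

/-- A principal connection: a smooth Lie algebra valued `1`-form which reproduces the generators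
of the fundamental vertical vector fields and satisfies `R_g^* Θ = Ad(g⁻¹) Θ`. -/
structure PrincipalConnection [IsManifold J 1 P] (B : PrincipalBundle I G J P K M) where
  form : Π p : P, TangentSpace J p →L[ℝ] GroupLieAlgebra I G
  smooth : ContMDiff (M' := E) J.tangent 𝓘(ℝ, E) ∞ (fun v : TangentBundle J P => form v.1 v.2)
  vertical : ∀ (p : P) (u : GroupLieAlgebra I G),
    form (B.act p 1) (mfderiv I J (fun g : G => B.act p g) 1 u) = u
  equivariant : ∀ (g : G) (p : P) (v : TangentSpace J p),
    form (B.act p g) (mfderiv J J (fun q : P => B.act q g) p v) = Ad I g⁻¹ (form p v)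

/-- The exterior derivative of a Lie algebra valued `1`-form. -/
def lieExtDeriv (Θ : Π p : P, TangentSpace J p →L[ℝ] GroupLieAlgebra I G) (p : P) :
    TangentSpace J p [⋀^Fin 2]→ₗ[ℝ] GroupLieAlgebra I G :=
  oneFormExtDeriv (F := E) J Θ p

variable [FiniteDimensional ℝ E] [LieGroup I ∞ G]

/-- The curvature `R = dΘ + ½ [Θ, Θ]` of a Lie algebra valued `1`-form `Θ`. -/
def curvature (Θ : Π p : P, TangentSpace J p →L[ℝ] GroupLieAlgebra I G) (p : P) :
    TangentSpace J p [⋀^Fin 2]→ₗ[ℝ] GroupLieAlgebra I G :=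
  lieExtDeriv Θ p +
    (1 / 2 : ℝ) • bracketForm (Θ p).toLinearMap (Θ p).toLinearMap

/-- The form `A_f(Ψ) = k f(Ψ, R_Θ, …, R_Θ)` on `P`. -/
def actionForm {k : ℕ} (f : InvariantPolynomial I G k)
    (Θ Ψ : Π p : P, TangentSpace J p →L[ℝ] GroupLieAlgebra I G) (p : P) :
    TangentSpace J p [⋀^Fin (2 * k - 1)]→ₗ[ℝ] ℂ :=
  (k : ℂ) • wedgeEval (Ψ p).toLinearMap (curvature Θ p) f.toMultilinearMap

/-- The pull-back to the total space of the Chern--Simons form: the integral `∫₀¹ A_f(dΘ_t/dt) dt`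
along the straight path `Θ_t = (1 - t) Θ₀ + t Θ₁`, evaluated on tangent vectors of `P` at `p`. -/
def totalChernSimons {k : ℕ} (f : InvariantPolynomial I G k)
    (Θ₀ Θ₁ : Π p : P, TangentSpace J p →L[ℝ] GroupLieAlgebra I G) (p : P)
    (v : Fin (2 * k - 1) → TangentSpace J p) : ℂ :=
  ∫ t in (0 : ℝ)..1, actionForm f (fun q => (1 - t) • Θ₀ q + t • Θ₁ q) (fun q => Θ₁ q - Θ₀ q) p v

variable [IsManifold J 1 P]

/-- `η` is the factorization through `M` of the form `∫₀¹ A_f(dΘ_t/dt) dt` on `P`. -/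
def IsChernSimonsForm {k : ℕ} (B : PrincipalBundle I G J P K M) (f : InvariantPolynomial I G k)
    (Θ₀ Θ₁ : PrincipalConnection B)
    (η : Π x : M, TangentSpace K x [⋀^Fin (2 * k - 1)]→ₗ[ℝ] ℂ) : Prop :=
  ∀ (p : P) (v : Fin (2 * k - 1) → TangentSpace J p),
    η (B.proj p) (fun i => mfderiv J K B.proj p (v i)) = totalChernSimons f Θ₀.form Θ₁.form p v

open Classical in
/-- The Chern--Simons form `CS_f(Θ₀, Θ₁)`: the form on `M` whose pull-back to `P` is
`∫₀¹ A_f(dΘ_t/dt) dt` along the straight path from `Θ₀` to `Θ₁`. -/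
def chernSimonsForm {k : ℕ} (B : PrincipalBundle I G J P K M) (f : InvariantPolynomial I G k)
    (Θ₀ Θ₁ : PrincipalConnection B) :
    Π x : M, TangentSpace K x [⋀^Fin (2 * k - 1)]→ₗ[ℝ] ℂ :=
  if h : ∃ η, IsChernSimonsForm B f Θ₀ Θ₁ η then h.choose else 0

end Bundles

section Tautological

variable {E : Type*} [NormedAddCommGroup E] [NormedSpace ℝ E]
  {H : Type*} [TopologicalSpace H] (I : ModelWithCorners ℝ E H)
  (G : Type*) [TopologicalSpace G] [ChartedSpace H G] [Group G] [LieGroup I ∞ G]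

/-- The tautological bundle `G × G → X_G = (G × G) / Δ(G)`. Here `X_G` is `G` with the action
`(g, h) · x = g x h⁻¹` of `G × G`, the projection is the orbit map `(g, h) ↦ g h⁻¹` of the base
point `1`, and `G` acts on `G × G` by diagonal right translations. -/
def tautologicalBundle : PrincipalBundle I G (I.prod I) (G × G) I G where
  proj p := p.1 * p.2⁻¹
  act p a := (p.1 * a, p.2 * a)
  smooth_proj := contMDiff_fst.mul contMDiff_snd.inv
  smooth_act := ((contMDiff_fst.comp contMDiff_fst).mul contMDiff_snd).prodMk
    ((contMDiff_snd.comp contMDiff_fst).mul contMDiff_snd)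
  act_one p := by simp
  act_mul p g h := by simp [mul_assoc]
  proj_act p g := by simp [mul_assoc]
  locally_trivial x₀ := ⟨Set.univ, isOpen_univ, Set.mem_univ _, fun x => (x, 1), Prod.snd,
    (contMDiff_id.prodMk contMDiff_const).contMDiffOn, contMDiff_snd.contMDiffOn,
    by simp, by simp, by simp⟩

variable {G}

theorem mdiff_mul_left (a x : G) : MDifferentiableAt I I (fun y : G => a * y) x :=
  (contMDiff_mul_left (I := I) (n := ∞)).mdifferentiableAt (by simp)

theorem mdiff_conj (a x : G) : MDifferentiableAt I I (fun y : G => a * y * a⁻¹) x :=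
  ((contMDiff_mul_left (I := I) (n := ∞)).mul contMDiff_const).mdifferentiableAt (by simp)

theorem mdiff_diag_right (a : G) (p : G × G) :
    MDifferentiableAt (I.prod I) (I.prod I) (fun q : G × G => (q.1 * a, q.2 * a)) p :=
  (((contMDiff_fst.mul contMDiff_const).prodMk (contMDiff_snd.mul contMDiff_const) :
    ContMDiff (I.prod I) (I.prod I) ∞ _)).mdifferentiableAt (by simp)

theorem mdiff_diag_left (p : G × G) (x : G) :
    MDifferentiableAt I (I.prod I) (fun a : G => (p.1 * a, p.2 * a)) x :=
  (((contMDiff_mul_left (I := I)).prodMk (contMDiff_mul_left (I := I)) :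
    ContMDiff I (I.prod I) ∞ _)).mdifferentiableAt (by simp)

/-- The value of the Maurer--Cartan form on the derivative of a curve or map. -/
theorem maurerCartan_comp {E₁ : Type*} [NormedAddCommGroup E₁] [NormedSpace ℝ E₁]
    {H₁ : Type*} [TopologicalSpace H₁] {J : ModelWithCorners ℝ E₁ H₁}
    {N : Type*} [TopologicalSpace N] [ChartedSpace H₁ N] (φ : N → G) (n : N)
    (hφ : MDifferentiableAt J I φ n) (v : TangentSpace J n) :
    maurerCartan I (φ n) (mfderiv J I φ n v) = mfderiv J I (fun m => (φ n)⁻¹ * φ m) n v := by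
  have := mfderiv_comp (I' := I) n (mdiff_mul_left I (φ n)⁻¹ (φ n)) hφ
  exact (congrArg (fun T => T v) this).symm

/-- The Maurer--Cartan form is smooth. -/
theorem contMDiff_maurerCartan :
    ContMDiff (M' := E) I.tangent 𝓘(ℝ, E) ∞
      (fun v : TangentBundle I G => maurerCartan I v.1 v.2) := by
  let F₁ : TangentBundle I G → TangentBundle I G × TangentBundle I G :=
    fun v => (Bundle.TotalSpace.mk' E (v.1⁻¹) 0, v)
  have sπ : ContMDiff I.tangent I ∞ (fun v : TangentBundle I G => v.1) :=
    Bundle.contMDiff_proj _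
  have S₁ : ContMDiff I.tangent (I.tangent.prod I.tangent) ∞ F₁ :=
    ((Bundle.contMDiff_zeroSection ℝ (TangentSpace I : G → Type _)).comp sπ.inv).prodMk contMDiff_id
  let F₂ : (TangentBundle I G × TangentBundle I G) → TangentBundle (I.prod I) (G × G) :=
    (equivTangentBundleProd I G I G).symm
  have S₂ : ContMDiff (I.tangent.prod I.tangent) (I.prod I).tangent ∞ F₂ :=
    contMDiff_equivTangentBundleProd_symm
  let F₃ : TangentBundle (I.prod I) (G × G) → TangentBundle I G :=
    tangentMap (I.prod I) I (fun p : G × G => p.1 * p.2)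
  have S₃ : ContMDiff (I.prod I).tangent I.tangent ∞ F₃ :=
    ContMDiff.contMDiff_tangentMap (contMDiff_mul I ∞) (by simp)
  have S := (S₃.comp S₂).comp S₁
  have key : ∀ v : TangentBundle I G, (F₃ ∘ F₂ ∘ F₁) v =
      (Bundle.TotalSpace.mk' E (1 : G) (maurerCartan I v.1 v.2)) := by
    intro v
    have h : (F₃ ∘ F₂ ∘ F₁) v =
        Bundle.TotalSpace.mk' E (v.1⁻¹ * v.1) (maurerCartan I v.1 v.2) := by
      simp only [Function.comp_apply, tangentMap, F₃, F₂, F₁]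
      rw [mfderiv_prod_eq_add_apply ((contMDiff_mul I ∞).mdifferentiableAt (by simp))]
      change Bundle.TotalSpace.mk' E (v.1⁻¹ * v.1)
        (mfderiv I I (fun z : G => z * v.1) v.1⁻¹ 0 +
          mfderiv I I (fun z : G => v.1⁻¹ * z) v.1 v.2) = _
      rw [map_zero]
      congr 1
      exact zero_add _
    rw [h, inv_mul_cancel]
  have S' : ContMDiff I.tangent I.tangent ∞ (fun v : TangentBundle I G =>
      (Bundle.TotalSpace.mk' E (1 : G) (maurerCartan I v.1 v.2) : TangentBundle I G)) := by
    have e : (F₃ ∘ F₂ ∘ F₁) = (fun v : TangentBundle I G =>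
      (Bundle.TotalSpace.mk' E (1 : G) (maurerCartan I v.1 v.2) : TangentBundle I G)) :=
      funext key
    rw [← e]; exact S
  intro v
  have := ((Bundle.contMDiffAt_totalSpace (F := E) (E := (TangentSpace I : G → Type _))).1
    (S' v)).2
  refine this.congr_of_eventuallyEq (Filter.Eventually.of_forall fun w => ?_)
  exact (tangentCoordChange_self (I := I) (x := (1 : G)) (z := (1 : G))
    (v := (maurerCartan I w.1 w.2 : E)) (mem_extChartAt_source (I := I) (1 : G))).symm

/-- The pull-back of the Maurer--Cartan form by `π`, evaluated on the derivative of `φ`. -/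
theorem maurerCartan_comp_comp {E₁ : Type*} [NormedAddCommGroup E₁] [NormedSpace ℝ E₁]
    {H₁ : Type*} [TopologicalSpace H₁] {J : ModelWithCorners ℝ E₁ H₁}
    {N : Type*} [TopologicalSpace N] [ChartedSpace H₁ N] (π : G × G → G) (φ : N → G × G) (n : N)
    (hπ : MDifferentiableAt (I.prod I) I π (φ n)) (hφ : MDifferentiableAt J (I.prod I) φ n)
    (v : TangentSpace J n) :
    maurerCartan I (π (φ n)) (mfderiv (I.prod I) I π (φ n) (mfderiv J (I.prod I) φ n v)) =
      mfderiv J I (fun m => (π (φ n))⁻¹ * π (φ m)) n v := by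
  rw [← maurerCartan_comp I (fun m => π (φ m)) n (hπ.comp n hφ) v]
  exact congrArg (fun T => maurerCartan I (π (φ n)) (T v))
    (mfderiv_comp (I' := I.prod I) n hπ hφ).symm

/-- The pull-back `π^* μ` by a smooth map `π : G × G → G` commuting with right translations. -/
def pullbackConnection (π : G × G → G) (hπ : ContMDiff (I.prod I) I ∞ π)
    (hr : ∀ (p : G × G) (a : G), π (p.1 * a, p.2 * a) = π p * a) :
    PrincipalConnection (tautologicalBundle I G) where
  form p := (maurerCartan I (π p)).comp (mfderiv (I.prod I) I π p)
  smooth := (contMDiff_maurerCartan I).comp (ContMDiff.contMDiff_tangentMap hπ (by simp))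
  vertical p u := by
    have h := maurerCartan_comp_comp I π (fun a : G => (p.1 * a, p.2 * a)) 1
      (hπ.mdifferentiableAt (by simp)) (mdiff_diag_left I p 1) u
    refine h.trans ?_
    have e : (fun a : G => (π (p.1 * 1, p.2 * 1))⁻¹ * π (p.1 * a, p.2 * a)) = id := by
      funext a; simp only [hr]; simp
    rw [e, mfderiv_id]
    rfl
  equivariant g p v := by
    have h := maurerCartan_comp_comp I π (fun q : G × G => (q.1 * g, q.2 * g)) p
      (hπ.mdifferentiableAt (by simp)) (mdiff_diag_right I g p) v
    refine h.trans ?_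
    have h1 : MDifferentiableAt (I.prod I) I (fun q => (π p)⁻¹ * π q) p :=
      (contMDiff_const.mul hπ).mdifferentiableAt (n := ∞) (by simp)
    have h2 := mfderiv_comp_of_eq (I' := I) (x := p) (y := 1) (mdiff_conj I g⁻¹ 1) h1 (by simp)
    have h3 := maurerCartan_comp I π p (hπ.mdifferentiableAt (by simp)) v
    have e : (fun q : G × G => (π (p.1 * g, p.2 * g))⁻¹ * π (q.1 * g, q.2 * g)) =
        (fun y : G => g⁻¹ * y * g⁻¹⁻¹) ∘ (fun q => (π p)⁻¹ * π q) := by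
      funext q; simp only [hr, Function.comp]; group
    have h4 : Ad I g⁻¹ (maurerCartan I (π p) (mfderiv (I.prod I) I π p v)) =
        Ad I g⁻¹ (mfderiv (I.prod I) I (fun q => (π p)⁻¹ * π q) p v) := congrArg _ h3
    refine Eq.trans ?_ h4.symm
    have h5 : ∀ x : G, x = 1 → ∀ w : E,
        (mfderiv I I (fun y : G => g⁻¹ * y * g⁻¹⁻¹) x : E →L[ℝ] E) w = (Ad I g⁻¹ : E →L[ℝ] E) w := by
      rintro _ rfl w
      rfl
    rw [e, h2]
    exact h5 _ (inv_mul_cancel _) _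

variable (G)

/-- The connection `Θ_L = p₂^* μ`, given by left parallelism on `G`. -/
def thetaL : PrincipalConnection (tautologicalBundle I G) :=
  pullbackConnection I Prod.snd contMDiff_snd (fun _ _ => rfl)

/-- The connection `Θ_R = p₁^* μ`, given by right parallelism on `G`. -/
def thetaR : PrincipalConnection (tautologicalBundle I G) :=
  pullbackConnection I Prod.fst contMDiff_fst (fun _ _ => rfl)

end Tautological

end ChernSimons

end

noncomputable section

namespace ChernSimons

section ChartForm

variable {E : Type*} [NormedAddCommGroup E] [NormedSpace ℝ E]
  {H : Type*} [TopologicalSpace H] (J : ModelWithCorners ℝ E H)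
  {P : Type*} [TopologicalSpace P] [ChartedSpace H P]
  {F : Type*} [NormedAddCommGroup F] [NormedSpace ℝ F]

/-- The expression of a `1`-form in the chart at `p`. -/
def chartForm (θ : Π p : P, TangentSpace J p →L[ℝ] F) (p : P) (y : E) : E →L[ℝ] F :=
  (θ ((extChartAt J p).symm y)).comp
    (mfderivWithin 𝓘(ℝ, E) J (extChartAt J p).symm (Set.range J) y)

/-- The derivative at `p` of the chart at `p`. -/
def chartDeriv (p : P) : TangentSpace J p →L[ℝ] E :=
  mfderiv J 𝓘(ℝ, E) (extChartAt J p) p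

variable {J} [J.Boundaryless]

theorem mfderivWithin_extChartAt_symm_range_eq [IsManifold J ∞ P] (p : P) {y : E}
    (hy : y ∈ (extChartAt J p).target) :
    mfderivWithin 𝓘(ℝ, E) J (extChartAt J p).symm (Set.range J) y =
      mfderivWithin 𝓘(ℝ, E) J (extChartAt J p).symm (extChartAt J p).target y := by
  rw [J.range_eq_univ, mfderivWithin_univ,
    mfderivWithin_of_isOpen (isOpen_extChartAt_target p) hy]

theorem differentiableAt_chartForm [FiniteDimensional ℝ E] [IsManifold J ∞ P]
    {θ : Π p : P, TangentSpace J p →L[ℝ] F}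
    (hθ : ContMDiff J.tangent 𝓘(ℝ, F) ∞ (fun v : TangentBundle J P => θ v.1 v.2)) (p : P) :
    DifferentiableAt ℝ (chartForm J θ p) (extChartAt J p p) := by
  have ho : IsOpen (extChartAt J p).target := isOpen_extChartAt_target p
  have key : ContDiffOn ℝ ∞ (chartForm J θ p) (extChartAt J p).target := by
    rw [contDiffOn_clm_apply]
    intro w
    rw [← contMDiffOn_iff_contDiffOn]
    have h1 := (contMDiffOn_extChartAt_symm (I := J) (n := ∞) p).contMDiffOn_tangentMapWithin
      (m := ∞) (by simp) ho.uniqueMDiffOn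
    have h2 : ContMDiff 𝓘(ℝ, E) 𝓘(ℝ, E).tangent ∞
        (fun y : E => (⟨y, w⟩ : TangentBundle 𝓘(ℝ, E) E)) :=
      contMDiff_vectorSpace_iff_contDiff.2 (contDiff_const (c := w))
    have h3 := (hθ.comp_contMDiffOn h1).comp h2.contMDiffOn
      (s := (extChartAt J p).target) (fun y hy => hy)
    refine h3.congr fun y hy => ?_
    simp only [chartForm, mfderivWithin_extChartAt_symm_range_eq p hy]
    rfl
  exact (key.contDiffAt (ho.mem_nhds (mem_extChartAt_target p))).differentiableAt (by simp)

theorem oneFormExtDeriv_apply {θ : Π p : P, TangentSpace J p →L[ℝ] F} {p : P}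
    (hθ : DifferentiableAt ℝ (chartForm J θ p) (extChartAt J p p))
    (v : Fin 2 → TangentSpace J p) :
    oneFormExtDeriv J θ p v =
      fderiv ℝ (chartForm J θ p) (extChartAt J p p)
          (chartDeriv J p (v 0))
          (chartDeriv J p (v 1)) -
        fderiv ℝ (chartForm J θ p) (extChartAt J p p)
          (chartDeriv J p (v 1))
          (chartDeriv J p (v 0)) := by
  have hd : DifferentiableAt ℝ (fun y => ContinuousAlternatingMap.ofSubsingletonLIE
      (𝕜 := ℝ) (E := E) (F := F) (0 : Fin 1) (chartForm J θ p y)) (extChartAt J p p) :=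
    (ContinuousAlternatingMap.ofSubsingletonLIE (𝕜 := ℝ) (E := E) (F := F)
      (0 : Fin 1)).differentiable.differentiableAt.comp _ hθ
  have hm : ∀ u : Fin 2 → E, extDeriv (fun y => ContinuousAlternatingMap.ofSubsingletonLIE
      (𝕜 := ℝ) (E := E) (F := F) (0 : Fin 1) (chartForm J θ p y)) (extChartAt J p p) u =
      fderiv ℝ (chartForm J θ p) (extChartAt J p p) (u 0) (u 1) -
        fderiv ℝ (chartForm J θ p) (extChartAt J p p) (u 1) (u 0) := by
    intro u
    rw [extDeriv_apply hd, Fin.sum_univ_two]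
    have e2 : ∀ (a b : E), fderiv ℝ (fun y => chartForm J θ p y a) (extChartAt J p p) b =
        fderiv ℝ (chartForm J θ p) (extChartAt J p p) b a := by
      intro a b
      rw [fderiv_clm_apply hθ (differentiableAt_const a)]
      simp
    have e3 : ∀ (i : Fin 2) (a : E) (_ : i.removeNth u 0 = a),
        (fun y => (ContinuousAlternatingMap.ofSubsingletonLIE
          (𝕜 := ℝ) (E := E) (F := F) (0 : Fin 1) (chartForm J θ p y)) (i.removeNth u)) =
        fun y => chartForm J θ p y a := by
      rintro i a rfl
      rfl
    rw [e3 0 (u 1) rfl, e3 1 (u 0) rfl, e2, e2]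
    simp [sub_eq_add_neg]
  have hr := hm (fun i => chartDeriv J p (v i))
  rw [← extDerivWithin_univ, ← J.range_eq_univ] at hr
  exact hr

theorem oneFormExtDeriv_lineMap {θ₀ θ₁ : Π p : P, TangentSpace J p →L[ℝ] F} {p : P}
    (h₀ : DifferentiableAt ℝ (chartForm J θ₀ p) (extChartAt J p p))
    (h₁ : DifferentiableAt ℝ (chartForm J θ₁ p) (extChartAt J p p)) (t : ℝ)
    (v : Fin 2 → TangentSpace J p) :
    oneFormExtDeriv J (fun q => (1 - t) • θ₀ q + t • θ₁ q) p v =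
      (1 - t) • oneFormExtDeriv J θ₀ p v + t • oneFormExtDeriv J θ₁ p v := by
  have e : chartForm J (fun q => (1 - t) • θ₀ q + t • θ₁ q) p =
      fun y => (1 - t) • chartForm J θ₀ p y + t • chartForm J θ₁ p y := by
    funext y
    rfl
  have hd : HasFDerivAt (chartForm J (fun q => (1 - t) • θ₀ q + t • θ₁ q) p)
      ((1 - t) • fderiv ℝ (chartForm J θ₀ p) (extChartAt J p p) +
        t • fderiv ℝ (chartForm J θ₁ p) (extChartAt J p p)) (extChartAt J p p) := by
    rw [e]
    exact (h₀.hasFDerivAt.const_smul (1 - t)).add (h₁.hasFDerivAt.const_smul t)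
  rw [oneFormExtDeriv_apply hd.differentiableAt, oneFormExtDeriv_apply h₀,
    oneFormExtDeriv_apply h₁, hd.fderiv]
  simp only [add_apply, smul_apply]
  module

end ChartForm

section Naturality

variable {E : Type*} [NormedAddCommGroup E] [NormedSpace ℝ E]
  {H : Type*} [TopologicalSpace H] {J : ModelWithCorners ℝ E H}
  {P : Type*} [TopologicalSpace P] [ChartedSpace H P]
  {E₂ : Type*} [NormedAddCommGroup E₂] [NormedSpace ℝ E₂]
  {H₂ : Type*} [TopologicalSpace H₂] {K : ModelWithCorners ℝ E₂ H₂}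
  {M : Type*} [TopologicalSpace M] [ChartedSpace H₂ M]
  {F : Type*} [NormedAddCommGroup F] [NormedSpace ℝ F]

theorem chartForm_apply_mfderiv [IsManifold J ∞ P] (θ : Π p : P, TangentSpace J p →L[ℝ] F)
    (p q : P) (hq : q ∈ (extChartAt J p).source) (w : TangentSpace J q) :
    chartForm J θ p (extChartAt J p q) (mfderiv J 𝓘(ℝ, E) (extChartAt J p) q w) = θ q w := by
  have : IsManifold J 1 P := IsManifold.of_le (n := ∞) (by simp)
  have h := mfderivWithin_extChartAt_symm_comp_mfderiv_extChartAt' (I := J) hq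
  have h1 : (mfderivWithin 𝓘(ℝ, E) J (extChartAt J p).symm (Set.range J) (extChartAt J p q))
      (mfderiv J 𝓘(ℝ, E) (extChartAt J p) q w) = (w : E) :=
    congrArg (fun T : E →L[ℝ] E => T w) h
  have h2 : ∀ z : P, z = q → ∀ u : E, (θ z : E →L[ℝ] F) u = (θ q : E →L[ℝ] F) u := by
    rintro z rfl u
    rfl
  exact (h2 _ ((extChartAt J p).left_inv hq) _).trans (congrArg (θ q : E →L[ℝ] F) h1)

variable [J.Boundaryless] [K.Boundaryless]

/-- The exterior derivative of a smooth `1`-form commutes with pull-back by a smooth map. -/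
theorem oneFormExtDeriv_pullback [FiniteDimensional ℝ E₂] [IsManifold J ∞ P] [IsManifold K ∞ M]
    {θ : Π m : M, TangentSpace K m →L[ℝ] F}
    (hθ : ContMDiff K.tangent 𝓘(ℝ, F) ∞ (fun v : TangentBundle K M => θ v.1 v.2))
    {π : P → M} (hπ : ContMDiff J K ∞ π) (p : P) (v : Fin 2 → TangentSpace J p) :
    oneFormExtDeriv J (fun q => (θ (π q)).comp (mfderiv J K π q)) p v =
      oneFormExtDeriv K θ (π p) (fun i => mfderiv J K π p (v i)) := by
  have iJ : IsManifold J 1 P := IsManifold.of_le (n := ∞) (by simp)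
  have iK : IsManifold K 1 M := IsManifold.of_le (n := ∞) (by simp)
  let φ : E → E₂ := fun y => extChartAt K (π p) (π ((extChartAt J p).symm y))
  have hy₀ : (extChartAt J p).symm (extChartAt J p p) = p := extChartAt_to_inv p
  have hnear : ∀ᶠ y in nhds (extChartAt J p p), y ∈ (extChartAt J p).target ∧
      π ((extChartAt J p).symm y) ∈ (extChartAt K (π p)).source := by
    refine Filter.Eventually.and (extChartAt_target_mem_nhds (I := J) p) ?_
    have hc : ContinuousAt (fun y => π ((extChartAt J p).symm y)) (extChartAt J p p) :=
      hπ.continuous.continuousAt.comp (continuousAt_extChartAt_symm p)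
    exact hc.preimage_mem_nhds (by rw [hy₀]; exact extChartAt_source_mem_nhds _)
  have hφ : ContDiffAt ℝ ∞ φ (extChartAt J p p) := by
    have h := (contMDiffAt_iff.1 (hπ p)).2
    rw [J.range_eq_univ, contDiffWithinAt_univ] at h
    exact h
  have hderiv : ∀ y, y ∈ (extChartAt J p).target →
      π ((extChartAt J p).symm y) ∈ (extChartAt K (π p)).source → ∀ w : E,
      fderiv ℝ φ y w = mfderiv K 𝓘(ℝ, E₂) (extChartAt K (π p)) (π ((extChartAt J p).symm y))
        (mfderiv J K π ((extChartAt J p).symm y)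
          (mfderivWithin 𝓘(ℝ, E) J (extChartAt J p).symm (Set.range J) y w)) := by
    intro y hy hs w
    have h1 : MDifferentiableAt 𝓘(ℝ, E) J (extChartAt J p).symm y :=
      ((contMDiffOn_extChartAt_symm (I := J) (n := ∞) p).contMDiffAt
        ((isOpen_extChartAt_target p).mem_nhds hy)).mdifferentiableAt (by simp)
    have h2 : MDifferentiableAt J K π ((extChartAt J p).symm y) :=
      hπ.mdifferentiableAt (by simp)
    have h3 : MDifferentiableAt K 𝓘(ℝ, E₂) (extChartAt K (π p)) (π ((extChartAt J p).symm y)) :=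
      mdifferentiableAt_extChartAt (by simpa using hs)
    let D : E →L[ℝ] E₂ :=
      (mfderiv K 𝓘(ℝ, E₂) (extChartAt K (π p)) (π ((extChartAt J p).symm y))).comp
        ((mfderiv J K π ((extChartAt J p).symm y)).comp
          (mfderiv 𝓘(ℝ, E) J (extChartAt J p).symm y))
    have h4 : HasFDerivAt φ D y := hasMFDerivAt_iff_hasFDerivAt.1
      (h3.hasMFDerivAt.comp y (h2.hasMFDerivAt.comp y h1.hasMFDerivAt))
    rw [h4.fderiv, J.range_eq_univ, mfderivWithin_univ]
    rfl
  have hchart : chartForm J (fun q => (θ (π q)).comp (mfderiv J K π q)) p =ᶠ[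
      nhds (extChartAt J p p)] fun y => (chartForm K θ (π p) (φ y)).comp (fderiv ℝ φ y) := by
    filter_upwards [hnear] with y hy
    ext w
    rw [ContinuousLinearMap.comp_apply, hderiv y hy.1 hy.2 w]
    exact (chartForm_apply_mfderiv θ (π p) _ hy.2 _).symm
  have hφ0 : φ (extChartAt J p p) = extChartAt K (π p) (π p) := by simp only [φ, hy₀]
  have hC : DifferentiableAt ℝ (chartForm K θ (π p)) (φ (extChartAt J p p)) := by
    rw [hφ0]; exact differentiableAt_chartForm hθ (π p)
  have hd1 : DifferentiableAt ℝ φ (extChartAt J p p) := hφ.differentiableAt (by simp)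
  have hd2 : DifferentiableAt ℝ (fderiv ℝ φ) (extChartAt J p p) :=
    (hφ.fderiv_right (m := 1)
      (by rw [one_add_one_eq_two]; exact ENat.LEInfty.out)).differentiableAt (by simp)
  have hsymm := hφ.isSymmSndFDerivAt (by simpa using ENat.LEInfty.out)
  have hD : HasFDerivAt (chartForm J (fun q => (θ (π q)).comp (mfderiv J K π q)) p)
      ((ContinuousLinearMap.compL ℝ E E₂ F
          (chartForm K θ (π p) (φ (extChartAt J p p)))).comp
            (fderiv ℝ (fderiv ℝ φ) (extChartAt J p p)) +
        ((ContinuousLinearMap.compL ℝ E E₂ F).flip (fderiv ℝ φ (extChartAt J p p))).comp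
          ((fderiv ℝ (chartForm K θ (π p)) (φ (extChartAt J p p))).comp
            (fderiv ℝ φ (extChartAt J p p)))) (extChartAt J p p) :=
    ((hC.hasFDerivAt.comp _ hd1.hasFDerivAt).clm_comp
      hd2.hasFDerivAt).congr_of_eventuallyEq hchart
  have hfst : ∀ w : TangentSpace J p, fderiv ℝ φ (extChartAt J p p) (chartDeriv J p w) =
      chartDeriv K (π p) (mfderiv J K π p w) := by
    intro w
    rw [hderiv _ (mem_extChartAt_target p) (by rw [hy₀]; exact mem_extChartAt_source _)]
    have h := mfderivWithin_extChartAt_symm_comp_mfderiv_extChartAt' (I := J)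
      (mem_extChartAt_source (I := J) p)
    have h1 : (mfderivWithin 𝓘(ℝ, E) J (extChartAt J p).symm (Set.range J) (extChartAt J p p))
        (chartDeriv J p w) = (w : E) :=
      congrArg (fun T : E →L[ℝ] E => T w) h
    have h2 : ∀ z : P, z = p → ∀ u u' : E, u = u' →
        (mfderiv K 𝓘(ℝ, E₂) (extChartAt K (π p)) (π z) : E₂ →L[ℝ] E₂)
          ((mfderiv J K π z : E →L[ℝ] E₂) u) =
        (chartDeriv K (π p) : E₂ →L[ℝ] E₂) ((mfderiv J K π p : E →L[ℝ] E₂) u') := by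
      rintro z rfl u _ rfl
      rfl
    exact h2 _ hy₀ _ _ h1
  rw [oneFormExtDeriv_apply hD.differentiableAt,
    oneFormExtDeriv_apply (differentiableAt_chartForm hθ (π p)), hD.fderiv]
  simp only [add_apply, ContinuousLinearMap.comp_apply, ContinuousLinearMap.compL_apply,
    ContinuousLinearMap.flip_apply]
  rw [hsymm (chartDeriv J p (v 0)) (chartDeriv J p (v 1)), ← hfst, ← hfst, ← hφ0]
  abel

end Naturality

section Structure

open VectorField

variable {E : Type*} [NormedAddCommGroup E] [NormedSpace ℝ E]
  {H : Type*} [TopologicalSpace H] {I : ModelWithCorners ℝ E H}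
  {G : Type*} [TopologicalSpace G] [ChartedSpace H G] [Group G]

theorem mfderiv_apply_congr_base {E' : Type*} [NormedAddCommGroup E'] [NormedSpace ℝ E']
    {H' : Type*} [TopologicalSpace H'] {I' : ModelWithCorners ℝ E' H'}
    {M N : Type*} [TopologicalSpace M] [ChartedSpace H M] [TopologicalSpace N] [ChartedSpace H' N]
    (φ : M → N) {z x : M} (h : z = x) (u : E) :
    (mfderiv I I' φ z : E →L[ℝ] E') u = (mfderiv I I' φ x : E →L[ℝ] E') u := by
  subst h
  rfl

theorem mulInvariantVectorField_congr_base (u : GroupLieAlgebra I G) {z x : G} (h : z = x) :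
    (mulInvariantVectorField u z : E) = (mulInvariantVectorField u x : E) := by
  subst h
  rfl

theorem mulInvariantVectorField_one (u : GroupLieAlgebra I G) :
    mulInvariantVectorField u (1 : G) = u := by
  have e : (fun y : G => 1 * y) = id := by funext y; simp
  rw [mulInvariantVectorField, e, mfderiv_id]
  rfl

variable [LieGroup I ∞ G]

theorem maurerCartan_mulInvariantVectorField (u : GroupLieAlgebra I G) (x : G) :
    maurerCartan I x (mulInvariantVectorField u x) = u := by
  have h := mfderiv_comp (I' := I) (1 : G) (mdiff_mul_left I x⁻¹ (x * 1)) (mdiff_mul_left I x 1)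
  have e : (fun y : G => x⁻¹ * y) ∘ (fun y : G => x * y) = id := by funext y; simp
  rw [e, mfderiv_id] at h
  refine Eq.trans ?_ (congrArg (fun T : E →L[ℝ] E => T u) h).symm
  exact (mfderiv_apply_congr_base (I := I) (I' := I) (fun y : G => x⁻¹ * y) (mul_one x) _).symm

theorem mulInvariantVectorField_maurerCartan (x : G) (w : TangentSpace I x) :
    mulInvariantVectorField (maurerCartan I x w) x = w := by
  have h := mfderiv_comp (I' := I) x (mdiff_mul_left I x (x⁻¹ * x)) (mdiff_mul_left I x⁻¹ x)
  have e : (fun y : G => x * y) ∘ (fun y : G => x⁻¹ * y) = id := by funext y; simp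
  rw [e, mfderiv_id] at h
  refine Eq.trans ?_ (congrArg (fun T : E →L[ℝ] E => T w) h).symm
  exact (mfderiv_apply_congr_base (I := I) (I' := I) (fun y : G => x * y)
    (inv_mul_cancel x) _).symm

/-- The derivative of a conjugation is invertible. -/
theorem isInvertible_mfderiv_conj (g x : G) :
    (mfderiv I I (fun y : G => g * y * g⁻¹) x).IsInvertible := by
  have h1 := mfderiv_comp (I' := I) x (mdiff_conj I g⁻¹ (g * x * g⁻¹)) (mdiff_conj I g x)
  have h2 := mfderiv_comp_of_eq (I' := I) (x := g * x * g⁻¹) (y := x)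
    (mdiff_conj I g x) (mdiff_conj I g⁻¹ (g * x * g⁻¹)) (by group)
  have e1 : (fun y : G => g⁻¹ * y * g⁻¹⁻¹) ∘ (fun y : G => g * y * g⁻¹) = id := by
    funext y; simp [mul_assoc]
  have e2 : (fun y : G => g * y * g⁻¹) ∘ (fun y : G => g⁻¹ * y * g⁻¹⁻¹) = id := by
    funext y; simp [mul_assoc]
  rw [e1, mfderiv_id] at h1
  rw [e2, mfderiv_id] at h2
  refine ContinuousLinearMap.IsInvertible.of_inverse
    (f := (mfderiv I I (fun y : G => g * y * g⁻¹) x : E →L[ℝ] E))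
    (g := (mfderiv I I (fun y : G => g⁻¹ * y * g⁻¹⁻¹) (g * x * g⁻¹) : E →L[ℝ] E)) ?_ h1.symm
  ext w
  refine Eq.trans ?_ (congrArg (fun T : E →L[ℝ] E => T w) h2).symm
  exact (mfderiv_apply_congr_base (I := I) (I' := I) (fun y : G => g * y * g⁻¹)
    (show g⁻¹ * (g * x * g⁻¹) * g⁻¹⁻¹ = x by group) _).symm

theorem mfderiv_conj_mulInvariantVectorField (g x : G) (u : GroupLieAlgebra I G) :
    mfderiv I I (fun y : G => g * y * g⁻¹) x (mulInvariantVectorField u x) =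
      mulInvariantVectorField (Ad I g u) (g * x * g⁻¹) := by
  have h1 := mfderiv_comp (I' := I) (1 : G) (mdiff_conj I g (x * 1)) (mdiff_mul_left I x 1)
  have h2 := mfderiv_comp (I' := I) (1 : G) (mdiff_mul_left I (g * x * g⁻¹) (g * 1 * g⁻¹))
    (mdiff_conj I g 1)
  have e : (fun y : G => g * y * g⁻¹) ∘ (fun y : G => x * y) =
      (fun y : G => (g * x * g⁻¹) * y) ∘ (fun y : G => g * y * g⁻¹) := by
    funext y; simp [mul_assoc]
  have h3 := (congrArg (fun T : E →L[ℝ] E => T u) h1).symm.trans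
    ((congrArg (fun φ : G → G => (mfderiv I I φ 1 : E →L[ℝ] E) u) e).trans
      (congrArg (fun T : E →L[ℝ] E => T u) h2))
  refine Eq.trans ?_ (h3.trans ?_)
  · exact (mfderiv_apply_congr_base (I := I) (I' := I) (fun y : G => g * y * g⁻¹)
      (mul_one x) _).symm
  · exact (mfderiv_apply_congr_base (I := I) (I' := I) (fun y : G => (g * x * g⁻¹) * y)
      (by simp) _)

variable [FiniteDimensional ℝ E]

theorem mlieBracket_mulInvariantVectorField (u w : GroupLieAlgebra I G) (x : G) :
    mlieBracket I (mulInvariantVectorField u) (mulInvariantVectorField w) x =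
      mulInvariantVectorField ⁅u, w⁆ x := by
  have := lieGroup_minSmoothness I G
  rw [GroupLieAlgebra.bracket_def, mulInvariantVector_mlieBracket]

/-- The Maurer--Cartan structure equation `dμ + ½ [μ, μ] = 0`. -/
theorem oneFormExtDeriv_maurerCartan [I.Boundaryless] (x : G) (v : Fin 2 → TangentSpace I x) :
    oneFormExtDeriv (F := E) I (maurerCartan I (G := G)) x v =
      -⁅maurerCartan I x (v 0), maurerCartan I x (v 1)⁆ := by
  have := lieGroup_minSmoothness I G
  have i1 : IsManifold I 1 G := IsManifold.of_le (n := ∞) (by simp)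
  have i2 : IsManifold I 2 G := IsManifold.of_le (n := ∞) ENat.LEInfty.out
  have hC := differentiableAt_chartForm (F := E) (θ := maurerCartan I (G := G))
    (contMDiff_maurerCartan I) x
  set C : E → E →L[ℝ] E := chartForm (F := E) I (maurerCartan I (G := G)) x
  have hs : (extChartAt I x).symm ⁻¹' Set.univ ∩ Set.range I = Set.univ := by
    simp [I.range_eq_univ]
  let V : GroupLieAlgebra I G → E → E := fun u =>
    mpullbackWithin 𝓘(ℝ, E) I (extChartAt I x).symm (mulInvariantVectorField u) (Set.range I)
  have hV : ∀ u, DifferentiableAt ℝ (V u) (extChartAt I x x) := by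
    intro u
    have h := (mdifferentiableAt_mulInvariantVectorField u
      (g := x)).mdifferentiableWithinAt (s := Set.univ)
      |>.differentiableWithinAt_mpullbackWithin_vectorField
    rw [hs] at h
    exact differentiableWithinAt_univ.1 h
  have hCV : ∀ u, ∀ y ∈ (extChartAt I x).target, C y (V u y) = (u : E) := by
    intro u y hy
    have hinv := isInvertible_mfderivWithin_extChartAt_symm (I := I) hy
    have h1 : mfderivWithin 𝓘(ℝ, E) I (extChartAt I x).symm (Set.range I) y (V u y) =
        mulInvariantVectorField u ((extChartAt I x).symm y) :=
      hinv.self_apply_inverse _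
    refine Eq.trans ?_ (maurerCartan_mulInvariantVectorField u ((extChartAt I x).symm y))
    exact congrArg (fun z => maurerCartan I ((extChartAt I x).symm y) z) h1
  have hV0 : ∀ w : TangentSpace I x,
      V (maurerCartan I x w) (extChartAt I x x) = chartDeriv I x w := by
    intro w
    have hinv := isInvertible_mfderivWithin_extChartAt_symm (I := I) (mem_extChartAt_target x)
    refine hinv.inverse_apply_eq.2 ?_
    refine Eq.trans (mulInvariantVectorField_congr_base (I := I) (x := x) _
      (extChartAt_to_inv (I := I) x)) ?_
    refine Eq.trans (mulInvariantVectorField_maurerCartan x w) ?_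
    exact (congrArg (fun T : E →L[ℝ] E => T w)
      (mfderivWithin_extChartAt_symm_comp_mfderiv_extChartAt' (I := I)
        (mem_extChartAt_source (I := I) x))).symm
  have hD : ∀ (u : GroupLieAlgebra I G) (a : E),
      fderiv ℝ C (extChartAt I x x) a (V u (extChartAt I x x)) =
        -C (extChartAt I x x) (fderiv ℝ (V u) (extChartAt I x x) a) := by
    intro u a
    have h1 := hC.hasFDerivAt.clm_apply (hV u).hasFDerivAt
    have h2 : HasFDerivAt (fun y => C y (V u y)) (0 : E →L[ℝ] E) (extChartAt I x x) :=
      (hasFDerivAt_const (u : E) (extChartAt I x x)).congr_of_eventuallyEq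
        (Filter.eventuallyEq_of_mem (extChartAt_target_mem_nhds x) (hCV u))
    have h3 := congrArg (fun T : E →L[ℝ] E => T a) (h1.unique h2)
    simp at h3
    rw [add_comm] at h3
    exact eq_neg_of_add_eq_zero_left h3
  rw [oneFormExtDeriv_apply hC, ← hV0, ← hV0, hD, hD]
  set u₀ := maurerCartan I x (v 0)
  set u₁ := maurerCartan I x (v 1)
  have hL : lieBracket ℝ (V u₀) (V u₁) (extChartAt I x x) =
      mfderiv I 𝓘(ℝ, E) (extChartAt I x) x
        (mlieBracket I (mulInvariantVectorField u₀) (mulInvariantVectorField u₁) x) := by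
    have hinv := isInvertible_mfderiv_extChartAt (I := I) (mem_extChartAt_source (I := I) x)
    rw [← mlieBracketWithin_univ, mlieBracketWithin_apply, hs]
    refine Eq.trans ?_ (hinv.self_apply_inverse _).symm
    exact (congrFun lieBracketWithin_univ _).symm
  have hM : C (extChartAt I x x) (lieBracket ℝ (V u₀) (V u₁) (extChartAt I x x)) =
      (⁅u₀, u₁⁆ : GroupLieAlgebra I G) := by
    rw [hL, mlieBracket_mulInvariantVectorField]
    refine Eq.trans (chartForm_apply_mfderiv (F := E) (maurerCartan I (G := G)) x x
      (mem_extChartAt_source x) _) ?_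
    exact maurerCartan_mulInvariantVectorField _ x
  rw [lieBracket, map_sub] at hM
  refine Eq.trans ?_ (congrArg Neg.neg hM)
  abel

theorem Ad_lie (g : G) (u w : GroupLieAlgebra I G) : Ad I g ⁅u, w⁆ = ⁅Ad I g u, Ad I g w⁆ := by
  have := lieGroup_minSmoothness I G
  have i2 : IsManifold I 2 G := IsManifold.of_le (n := ∞) ENat.LEInfty.out
  have hpull : ∀ u : GroupLieAlgebra I G, mpullback I I (fun y : G => g * y * g⁻¹)
      (mulInvariantVectorField (Ad I g u)) = mulInvariantVectorField u := by
    intro u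
    funext x
    rw [mpullback_apply]
    exact (isInvertible_mfderiv_conj g x).inverse_apply_eq.2
      (mfderiv_conj_mulInvariantVectorField g x u).symm
  have hsm : ContMDiff I I ∞ (fun y : G => g * y * g⁻¹) :=
    contMDiff_mul_left.mul contMDiff_const
  have h := mpullback_mlieBracket (n := minSmoothness ℝ 3) (f := fun y : G => g * y * g⁻¹)
    (x₀ := (1 : G))
    (mdifferentiableAt_mulInvariantVectorField (Ad I g u))
    (mdifferentiableAt_mulInvariantVectorField (Ad I g w))
    ((hsm 1).of_le (by simpa using ENat.LEInfty.out)) (minSmoothness_monotone (by norm_cast))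
  rw [hpull, hpull, mpullback_apply, mlieBracket_mulInvariantVectorField,
    mlieBracket_mulInvariantVectorField, mulInvariantVectorField_one] at h
  have h1 := (isInvertible_mfderiv_conj g 1).inverse_apply_eq.1 h
  refine Eq.trans h1.symm ?_
  refine Eq.trans (mulInvariantVectorField_congr_base (I := I) (x := 1) _ (by simp)) ?_
  exact mulInvariantVectorField_one _

end Structure

theorem integral_mul_one_sub_pow (n : ℕ) :
    ∫ t in (0 : ℝ)..1, ((t : ℂ) * (1 - t)) ^ n =
      (n.factorial * n.factorial : ℂ) / (2 * n + 1).factorial := by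
  have h := Complex.Gamma_mul_Gamma_eq_betaIntegral (s := n + 1) (t := n + 1)
    (by simp; positivity) (by simp; positivity)
  have e : ((n : ℂ) + 1 + (n + 1)) = ((2 * n + 1 : ℕ) : ℂ) + 1 := by push_cast; ring
  rw [e, Complex.Gamma_nat_eq_factorial, Complex.Gamma_nat_eq_factorial] at h
  rw [h, mul_div_cancel_left₀ _ (by exact_mod_cast Nat.factorial_ne_zero _), Complex.betaIntegral]
  refine intervalIntegral.integral_congr fun t _ => ?_
  simp only [add_sub_cancel_right, Complex.cpow_natCast, mul_pow]

section Wedge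

variable {V V' L : Type*} [AddCommGroup V] [Module ℝ V] [AddCommGroup V'] [Module ℝ V']
  [AddCommGroup L] [Module ℝ L] {k : ℕ}

theorem wedgeEval_apply (α : V →ₗ[ℝ] L) (β : V [⋀^Fin 2]→ₗ[ℝ] L)
    (f : MultilinearMap ℝ (fun _ : Fin k => L) ℂ) (v : Fin (2 * k - 1) → V) :
    wedgeEval α β f v = (1 / 2 : ℂ) ^ (k - 1) *
      ∑ σ : Equiv.Perm (Fin (2 * k - 1)), Equiv.Perm.sign σ • f (slot α β (fun i => v (σ i))) := by
  rw [wedgeEval, AlternatingMap.smul_apply, smul_eq_mul, MultilinearMap.alternatization_apply]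
  rfl

/-- Naturality of `f(α, β, …, β)` under pull-back and an automorphism preserving `f`. -/
theorem wedgeEval_congr (α : V →ₗ[ℝ] L) (β : V [⋀^Fin 2]→ₗ[ℝ] L) (α' : V' →ₗ[ℝ] L)
    (β' : V' [⋀^Fin 2]→ₗ[ℝ] L) (f : MultilinearMap ℝ (fun _ : Fin k => L) ℂ) (T : V → V')
    (A : L → L) (hA : ∀ u : Fin k → L, f (fun i => A (u i)) = f u)
    (hα : ∀ v, α' (T v) = A (α v)) (hβ : ∀ v w, β' ![T v, T w] = A (β ![v, w]))
    (v : Fin (2 * k - 1) → V) :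
    wedgeEval α' β' f (fun i => T (v i)) = wedgeEval α β f v := by
  simp only [wedgeEval_apply]
  congr 1
  refine Finset.sum_congr rfl fun σ _ => ?_
  rw [← hA (slot α β _)]
  congr 2
  funext i
  unfold slot
  split_ifs
  · exact hα _
  · exact hβ _ _

theorem map_slot_smul (hk : 1 ≤ k) (α : V →ₗ[ℝ] L) (β : V [⋀^Fin 2]→ₗ[ℝ] L) (a b : ℝ)
    (f : MultilinearMap ℝ (fun _ : Fin k => L) ℂ) (v : Fin (2 * k - 1) → V) :
    f (slot (a • α) (b • β) v) = ((a * b ^ (k - 1) : ℝ) : ℂ) * f (slot α β v) := by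
  obtain ⟨n, rfl⟩ : ∃ n, k = n + 1 := ⟨k - 1, by omega⟩
  have e : slot (a • α) (b • β) v =
      fun i : Fin (n + 1) => (Fin.cons a (fun _ => b) : Fin (n + 1) → ℝ) i • slot α β v i := by
    funext i
    refine Fin.cases ?_ (fun j => ?_) i
    · simp [slot]
    · simp [slot]
  rw [e, f.map_smul_univ, Fin.prod_univ_succ]
  simp

theorem wedgeEval_smul (hk : 1 ≤ k) (α : V →ₗ[ℝ] L) (β : V [⋀^Fin 2]→ₗ[ℝ] L) (a b : ℝ)
    (f : MultilinearMap ℝ (fun _ : Fin k => L) ℂ) (v : Fin (2 * k - 1) → V) :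
    wedgeEval (a • α) (b • β) f v = ((a * b ^ (k - 1) : ℝ) : ℂ) * wedgeEval α β f v := by
  simp only [wedgeEval_apply, map_slot_smul hk, mul_left_comm _ ((1 / 2 : ℂ) ^ (k - 1))]
  congr 1
  rw [Finset.mul_sum]
  refine Finset.sum_congr rfl fun σ _ => ?_
  rw [mul_smul_comm]

end Wedge

theorem lie_segment_identity {L : Type*} [LieRing L] [LieAlgebra ℝ L] (t : ℝ) (x₀ x₁ y₀ y₁ : L) :
    (1 - t) • -⁅x₀, x₁⁆ + t • -⁅y₀, y₁⁆ +
        (1 / 2 : ℝ) • (⁅(1 - t) • x₀ + t • y₀, (1 - t) • x₁ + t • y₁⁆ -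
          ⁅(1 - t) • x₁ + t • y₁, (1 - t) • x₀ + t • y₀⁆) =
      (-(t * (1 - t) / 2)) • (⁅y₀ - x₀, y₁ - x₁⁆ - ⁅y₁ - x₁, y₀ - x₀⁆) := by
  rw [← lie_skew ((1 - t) • x₀ + t • y₀), ← lie_skew (y₀ - x₀) (y₁ - x₁), ← lie_skew x₀ x₁,
    ← lie_skew y₀ y₁]
  simp only [add_lie, lie_add, sub_lie, lie_sub, smul_lie, lie_smul]
  module

section Curvature

variable {E : Type*} [NormedAddCommGroup E] [NormedSpace ℝ E] [FiniteDimensional ℝ E]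
  {H : Type*} [TopologicalSpace H] {I : ModelWithCorners ℝ E H}
  {G : Type*} [TopologicalSpace G] [ChartedSpace H G] [Group G] [LieGroup I ∞ G]

theorem bracketForm_apply {V : Type*} [AddCommGroup V] [Module ℝ V]
    (α β : V →ₗ[ℝ] GroupLieAlgebra I G) (v : Fin 2 → V) :
    bracketForm α β v = ⁅α (v 0), β (v 1)⁆ - ⁅α (v 1), β (v 0)⁆ := rfl

variable [I.Boundaryless]

theorem lieExtDeriv_pullbackConnection (π : G × G → G) (hπ : ContMDiff (I.prod I) I ∞ π)
    (hr : ∀ (p : G × G) (a : G), π (p.1 * a, p.2 * a) = π p * a) (p : G × G)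
    (v : Fin 2 → TangentSpace (I.prod I) p) :
    lieExtDeriv (pullbackConnection I π hπ hr).form p v =
      -⁅(pullbackConnection I π hπ hr).form p (v 0), (pullbackConnection I π hπ hr).form p (v 1)⁆ :=
  (oneFormExtDeriv_pullback (F := E) (contMDiff_maurerCartan I) hπ p v).trans
    (oneFormExtDeriv_maurerCartan (π p) _)

theorem curvature_segment (p : G × G) (t : ℝ) :
    curvature (fun q => (1 - t) • (thetaL I G).form q + t • (thetaR I G).form q) p =
      (-(t * (1 - t) / 2)) • bracketForm
        ((thetaR I G).form p - (thetaL I G).form p).toLinearMap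
        ((thetaR I G).form p - (thetaL I G).form p).toLinearMap := by
  have := lieGroup_minSmoothness I G
  ext v
  have h := oneFormExtDeriv_lineMap (F := E) (p := p)
    (differentiableAt_chartForm (thetaL I G).smooth p)
    (differentiableAt_chartForm (thetaR I G).smooth p) t v
  have hL := lieExtDeriv_pullbackConnection (I := I) (G := G) Prod.snd contMDiff_snd
    (fun _ _ => rfl) p v
  have hR := lieExtDeriv_pullbackConnection (I := I) (G := G) Prod.fst contMDiff_fst
    (fun _ _ => rfl) p v
  have h2 := lie_segment_identity t ((thetaL I G).form p (v 0)) ((thetaL I G).form p (v 1))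
    ((thetaR I G).form p (v 0)) ((thetaR I G).form p (v 1))
  refine Eq.trans ?_ h2
  refine congrArg₂ (· + ·) (h.trans ?_) rfl
  exact congrArg₂ (fun a b : GroupLieAlgebra I G => (1 - t) • a + t • b) hL hR

end Curvature

section Derivatives

variable {E : Type*} [NormedAddCommGroup E] [NormedSpace ℝ E]
  {H : Type*} [TopologicalSpace H] {I : ModelWithCorners ℝ E H}
  {G : Type*} [TopologicalSpace G] [ChartedSpace H G] [Group G] [LieGroup I ∞ G]

theorem mdifferentiableAt_inv (x : G) : MDifferentiableAt I I (fun y : G => y⁻¹) x :=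
  (contMDiff_inv I ∞).mdifferentiableAt (by simp)

theorem mfderiv_inv_one (u : GroupLieAlgebra I G) :
    (mfderiv I I (fun y : G => y⁻¹) 1 u : E) = -(u : E) := by
  have hm : MDifferentiableAt (I.prod I) I (fun q : G × G => q.1 * q.2) (1, 1) :=
    (contMDiff_mul I ∞).mdifferentiableAt (by simp)
  have hp : MDifferentiableAt I (I.prod I) (fun y : G => (y, y⁻¹)) 1 :=
    mdifferentiableAt_id.prodMk (mdifferentiableAt_inv 1)
  have h := mfderiv_comp_of_eq (I' := I.prod I) hm hp (by simp)
  have e : (fun q : G × G => q.1 * q.2) ∘ (fun y : G => (y, y⁻¹)) = fun _ => 1 := by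
    funext y; simp
  rw [e, mfderiv_const] at h
  have hd : (mfderiv I (I.prod I) (fun y : G => (y, y⁻¹)) 1 u : E × E) =
      (u, mfderiv I I (fun y : G => y⁻¹) 1 u) := by
    refine (congrArg (fun T : E →L[ℝ] E × E => T u)
      (mfderiv_prodMk (mdifferentiableAt_id (I := I)) (mdifferentiableAt_inv (1 : G)))).trans ?_
    rw [mfderiv_id]
    rfl
  have h1 := ((congrArg (fun T : E →L[ℝ] E => T u) h).trans
    (mfderiv_apply_congr_base (I := I.prod I) (I' := I) (fun q : G × G => q.1 * q.2)
      (x := (1, 1)) (by simp) _)).trans (congrArg (mfderiv (I.prod I) I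
        (fun q : G × G => q.1 * q.2) (1, 1) : E × E →L[ℝ] E) hd)
  have h2 := mfderiv_prod_eq_add_apply hm
    (v := ((u, mfderiv I I (fun y : G => y⁻¹) 1 u) : E × E))
  have e1 : (fun z : G => z * (1 : G)) = id := by funext z; simp
  have e2 : (fun z : G => (1 : G) * z) = id := by funext z; simp
  have h3 : (0 : E) = mfderiv I I (fun z : G => z * (1 : G)) 1 u +
      mfderiv I I (fun z : G => (1 : G) * z) 1 (mfderiv I I (fun y : G => y⁻¹) 1 u) :=
    h1.trans h2
  rw [e1, e2, mfderiv_id] at h3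
  exact eq_neg_of_add_eq_zero_right h3.symm

theorem mfderiv_conj_left_translation (a g : G) (w : TangentSpace I a) :
    (mfderiv I I (fun z : G => g * (a⁻¹ * z) * g⁻¹) a w : E) = Ad I g (maurerCartan I a w) := by
  have h := mfderiv_comp_of_eq (I' := I) (x := a) (y := 1) (mdiff_conj I g 1)
    (mdiff_mul_left I a⁻¹ a) (inv_mul_cancel a)
  refine (congrArg (fun T : E →L[ℝ] E => T w) h).trans ?_
  exact mfderiv_apply_congr_base (I := I) (I' := I) (fun y : G => g * y * g⁻¹)
    (inv_mul_cancel a) _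

theorem mfderiv_mul_inv_self (a : G) (w : TangentSpace I a) :
    (mfderiv I I (fun z : G => a * z⁻¹) a w : E) = -(Ad I a (maurerCartan I a w) : E) := by
  have hc : MDifferentiableAt I I (fun y : G => a * (a⁻¹ * y) * a⁻¹) a :=
    (contMDiff_mul_left (I := I) (n := ∞) |>.comp contMDiff_mul_left |>.mul
      contMDiff_const).mdifferentiableAt (by simp)
  have h := mfderiv_comp_of_eq (I' := I) (x := a) (y := 1) (mdifferentiableAt_inv 1) hc (by simp)
  have e : (fun y : G => y⁻¹) ∘ (fun y : G => a * (a⁻¹ * y) * a⁻¹) = fun z : G => a * z⁻¹ := by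
    funext y; simp
  rw [e] at h
  refine (congrArg (fun T : E →L[ℝ] E => T w) h).trans ?_
  refine (mfderiv_apply_congr_base (I := I) (I' := I) (fun y : G => y⁻¹) (x := 1)
    (show a * (a⁻¹ * a) * a⁻¹ = 1 by simp) _).trans ?_
  refine (mfderiv_inv_one _).trans ?_
  exact congrArg Neg.neg (mfderiv_conj_left_translation a a w)

theorem maurerCartan_mfderiv_inv (x : G) (w : TangentSpace I x) :
    maurerCartan I x⁻¹ (mfderiv I I (fun y : G => y⁻¹) x w) = -Ad I x (maurerCartan I x w) := by
  refine (maurerCartan_comp I (fun y : G => y⁻¹) x (mdifferentiableAt_inv x) w).trans ?_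
  have e : (fun y : G => x⁻¹⁻¹ * y⁻¹) = fun y => x * y⁻¹ := by funext y; simp
  refine (congrArg (fun φ : G → G => (mfderiv I I φ x : E →L[ℝ] E) w) e).trans ?_
  exact mfderiv_mul_inv_self x w

theorem maurerCartan_mfderiv_proj (p : G × G) (v : TangentSpace (I.prod I) p) :
    maurerCartan I (p.1 * p.2⁻¹) (mfderiv (I.prod I) I (fun q : G × G => q.1 * q.2⁻¹) p v) =
      Ad I p.2 (((thetaR I G).form p - (thetaL I G).form p) v) := by
  have hR : (thetaR I G).form p v = maurerCartan I p.1 v.1 := by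
    change maurerCartan I p.1 (mfderiv (I.prod I) I Prod.fst p v) = _
    rw [mfderiv_fst]
    rfl
  have hL : (thetaL I G).form p v = maurerCartan I p.2 v.2 := by
    change maurerCartan I p.2 (mfderiv (I.prod I) I Prod.snd p v) = _
    rw [mfderiv_snd]
    rfl
  have hπ : ContMDiff (I.prod I) I ∞ (fun q : G × G => q.1 * q.2⁻¹) :=
    contMDiff_fst.mul contMDiff_snd.inv
  refine (maurerCartan_comp I (fun q : G × G => q.1 * q.2⁻¹) p
    (hπ.mdifferentiableAt (by simp)) v).trans ?_
  refine (mfderiv_prod_eq_add_apply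
    ((contMDiff_const.mul hπ).mdifferentiableAt (n := ∞) (by simp))).trans ?_
  have e1 : (fun z : G => (p.1 * p.2⁻¹)⁻¹ * (z * p.2⁻¹)) =
      fun z : G => p.2 * (p.1⁻¹ * z) * p.2⁻¹ := by funext z; simp [mul_assoc]
  have e2 : (fun z : G => (p.1 * p.2⁻¹)⁻¹ * (p.1 * z⁻¹)) = fun z : G => p.2 * z⁻¹ := by
    funext z; simp [mul_assoc]
  have h1 : (mfderiv I I (fun z : G => (p.1 * p.2⁻¹)⁻¹ * (z * p.2⁻¹)) p.1 v.1 : E) =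
      Ad I p.2 (maurerCartan I p.1 v.1) := by
    rw [e1]; exact mfderiv_conj_left_translation p.1 p.2 v.1
  have h2 : (mfderiv I I (fun z : G => (p.1 * p.2⁻¹)⁻¹ * (p.1 * z⁻¹)) p.2 v.2 : E) =
      -(Ad I p.2 (maurerCartan I p.2 v.2) : E) := by
    rw [e2]; exact mfderiv_mul_inv_self p.2 v.2
  refine (congrArg₂ (fun a b : E => a + b) h1 h2).trans ?_
  rw [sub_apply, hR, hL, map_sub]
  exact (sub_eq_add_neg _ _).symm

end Derivatives

section Assembly

variable {E : Type*} [NormedAddCommGroup E] [NormedSpace ℝ E] [FiniteDimensional ℝ E]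
  {H : Type*} [TopologicalSpace H] {I : ModelWithCorners ℝ E H}
  {G : Type*} [TopologicalSpace G] [ChartedSpace H G] [Group G] [LieGroup I ∞ G] {k : ℕ}

theorem bracketForm_Ad {V V' : Type*} [AddCommGroup V] [Module ℝ V] [AddCommGroup V'] [Module ℝ V']
    (α : V →ₗ[ℝ] GroupLieAlgebra I G) (α' : V' →ₗ[ℝ] GroupLieAlgebra I G) (T : V → V') (g : G)
    (h : ∀ v, α' (T v) = Ad I g (α v)) (v w : V) :
    bracketForm α' α' ![T v, T w] = Ad I g (bracketForm α α ![v, w]) := by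
  simp only [bracketForm_apply, Matrix.cons_val_zero, Matrix.cons_val_one, h, map_sub, Ad_lie]

theorem wedgeEval_bracketForm_Ad {V V' : Type*} [AddCommGroup V] [Module ℝ V] [AddCommGroup V']
    [Module ℝ V'] (f : InvariantPolynomial I G k)
    (α : V →ₗ[ℝ] GroupLieAlgebra I G) (α' : V' →ₗ[ℝ] GroupLieAlgebra I G) (T : V → V') (g : G)
    (h : ∀ v, α' (T v) = Ad I g (α v)) (v : Fin (2 * k - 1) → V) :
    wedgeEval α' (bracketForm α' α') f.toMultilinearMap (fun i => T (v i)) =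
      wedgeEval α (bracketForm α α) f.toMultilinearMap v :=
  wedgeEval_congr _ _ _ _ _ T (Ad I g) (f.invariant g) h (bracketForm_Ad α α' T g h) v

theorem tau_proj (f : InvariantPolynomial I G k) (p : G × G)
    (v : Fin (2 * k - 1) → TangentSpace (I.prod I) p) :
    tau f (p.1 * p.2⁻¹) (fun i => mfderiv (I.prod I) I (fun q : G × G => q.1 * q.2⁻¹) p (v i)) =
      wedgeEval ((thetaR I G).form p - (thetaL I G).form p).toLinearMap
        (bracketForm ((thetaR I G).form p - (thetaL I G).form p).toLinearMap
          ((thetaR I G).form p - (thetaL I G).form p).toLinearMap) f.toMultilinearMap v :=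
  wedgeEval_bracketForm_Ad f _ _ _ p.2 (maurerCartan_mfderiv_proj p) v

theorem tau_inv (hk : 1 ≤ k) (f : InvariantPolynomial I G k) (x : G)
    (v : Fin (2 * k - 1) → TangentSpace I x) :
    tau f x⁻¹ (fun i => mfderiv I I (fun y : G => y⁻¹) x (v i)) = -tau f x v := by
  have h := wedgeEval_bracketForm_Ad f ((-1 : ℝ) • (maurerCartan I x).toLinearMap)
    (maurerCartan I x⁻¹).toLinearMap (mfderiv I I (fun y : G => y⁻¹) x) x
    (fun w => (maurerCartan_mfderiv_inv x w).trans (by simp)) v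
  refine Eq.trans h ?_
  have e : bracketForm ((-1 : ℝ) • (maurerCartan I x).toLinearMap)
      ((-1 : ℝ) • (maurerCartan I x).toLinearMap) =
      (1 : ℝ) • bracketForm (maurerCartan I x).toLinearMap (maurerCartan I x).toLinearMap := by
    have := lieGroup_minSmoothness I G
    ext w
    simp [bracketForm_apply]
  rw [e, wedgeEval_smul hk]
  simp [tau]

/-- The constant `(-1)^(k-1) k! (k-1)! / (2^(k-1) (2k-1)!)`. -/
def chernSimonsConst (k : ℕ) : ℂ :=
  (-1 : ℂ) ^ (k - 1) * (k.factorial * (k - 1).factorial) /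
    (2 ^ (k - 1) * (2 * k - 1).factorial)

theorem integral_chernSimonsConst (hk : 1 ≤ k) :
    ∫ t in (0 : ℝ)..1, (k : ℂ) * (((-(t * (1 - t) / 2)) ^ (k - 1) : ℝ) : ℂ) =
      chernSimonsConst k := by
  obtain ⟨n, rfl⟩ : ∃ n, k = n + 1 := ⟨k - 1, by omega⟩
  have e : ∀ t : ℝ, ((n + 1 : ℕ) : ℂ) * (((-(t * (1 - t) / 2)) ^ (n + 1 - 1) : ℝ) : ℂ) =
      ((n + 1 : ℕ) * (-1) ^ n / 2 ^ n : ℂ) * ((t : ℂ) * (1 - t)) ^ n := by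
    intro t
    rw [Nat.add_sub_cancel, show -(t * (1 - t) / 2) = (-1) * (t * (1 - t)) / 2 by ring, div_pow,
      mul_pow]
    push_cast
    ring
  simp only [e]
  rw [intervalIntegral.integral_const_mul, integral_mul_one_sub_pow, chernSimonsConst,
    Nat.factorial_succ n, Nat.add_sub_cancel, show 2 * (n + 1) - 1 = 2 * n + 1 by omega]
  push_cast
  field_simp

theorem IsChernSimonsForm.unique {f : InvariantPolynomial I G k}
    {η η' : Π x : G, TangentSpace I x [⋀^Fin (2 * k - 1)]→ₗ[ℝ] ℂ}
    (h : IsChernSimonsForm (tautologicalBundle I G) f (thetaL I G) (thetaR I G) η)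
    (h' : IsChernSimonsForm (tautologicalBundle I G) f (thetaL I G) (thetaR I G) η') :
    η = η' := by
  funext x
  ext w
  have hs : ContMDiff I (I.prod I) ∞ (fun y : G => (y, (1 : G))) :=
    contMDiff_id.prodMk contMDiff_const
  have hπ : ContMDiff (I.prod I) I ∞ (fun q : G × G => q.1 * q.2⁻¹) :=
    contMDiff_fst.mul contMDiff_snd.inv
  have hc := mfderiv_comp (I' := I.prod I) x (hπ.mdifferentiableAt (by simp))
    (hs.mdifferentiableAt (x := x) (by simp))
  have e : (fun q : G × G => q.1 * q.2⁻¹) ∘ (fun y : G => (y, (1 : G))) = id := by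
    funext y; simp
  rw [e, mfderiv_id] at hc
  have hw : (fun i => mfderiv (I.prod I) I (fun q : G × G => q.1 * q.2⁻¹) (x, 1)
      (mfderiv I (I.prod I) (fun y : G => (y, (1 : G))) x (w i)) : Fin (2 * k - 1) → E) = w := by
    funext i
    exact (congrArg (fun T : E →L[ℝ] E => T (w i)) hc).symm
  have hb : ∀ (ζ : Π x : G, TangentSpace I x [⋀^Fin (2 * k - 1)]→ₗ[ℝ] ℂ) (z : G), z = x →
      ∀ u : Fin (2 * k - 1) → E, u = w →
      (ζ z : E [⋀^Fin (2 * k - 1)]→ₗ[ℝ] ℂ) u = (ζ x : E [⋀^Fin (2 * k - 1)]→ₗ[ℝ] ℂ) w := by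
    rintro ζ z rfl u rfl
    rfl
  have h1 := h (x, 1) (fun i => mfderiv I (I.prod I) (fun y : G => (y, (1 : G))) x (w i))
  have h2 := h' (x, 1) (fun i => mfderiv I (I.prod I) (fun y : G => (y, (1 : G))) x (w i))
  exact (hb η _ (by simp [tautologicalBundle]) _ hw).symm.trans
    ((h1.trans h2.symm).trans (hb η' _ (by simp [tautologicalBundle]) _ hw))

variable [I.Boundaryless]

theorem totalChernSimons_eq (hk : 1 ≤ k) (f : InvariantPolynomial I G k) (p : G × G)
    (v : Fin (2 * k - 1) → TangentSpace (I.prod I) p) :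
    totalChernSimons f (thetaL I G).form (thetaR I G).form p v =
      chernSimonsConst k * wedgeEval ((thetaR I G).form p - (thetaL I G).form p).toLinearMap
        (bracketForm ((thetaR I G).form p - (thetaL I G).form p).toLinearMap
          ((thetaR I G).form p - (thetaL I G).form p).toLinearMap) f.toMultilinearMap v := by
  rw [← integral_chernSimonsConst hk, ← intervalIntegral.integral_mul_const]
  refine intervalIntegral.integral_congr fun t _ => ?_
  simp only [actionForm, curvature_segment, AlternatingMap.smul_apply, smul_eq_mul]
  rw [← one_smul ℝ ((thetaR I G).form p - (thetaL I G).form p).toLinearMap, wedgeEval_smul hk,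
    one_smul, one_mul, mul_assoc]

theorem isChernSimonsForm_tau (hk : 1 ≤ k) (f : InvariantPolynomial I G k) :
    IsChernSimonsForm (tautologicalBundle I G) f (thetaL I G) (thetaR I G)
      (fun x => chernSimonsConst k • tau f x) := by
  intro p v
  rw [totalChernSimons_eq hk]
  exact congrArg (chernSimonsConst k * ·) (tau_proj f p v)

theorem chernSimonsForm_tautological (hk : 1 ≤ k) (f : InvariantPolynomial I G k) :
    chernSimonsForm (tautologicalBundle I G) f (thetaL I G) (thetaR I G) =
      fun x => chernSimonsConst k • tau f x := by
  have h : ∃ η, IsChernSimonsForm (tautologicalBundle I G) f (thetaL I G) (thetaR I G) η :=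
    ⟨_, isChernSimonsForm_tau hk f⟩
  rw [chernSimonsForm, dif_pos h]
  exact h.choose_spec.unique (isChernSimonsForm_tau hk f)

end Assembly

end ChernSimons

end

open ChernSimons in
/-- For a Lie group `G` and an invariant polynomial `f` of degree `k ≥ 1`, the Chern--Simons form of
the pair `(Θ_L, Θ_R)` is well defined on `X_G` and is an explicit multiple of `τ(f)`. The second
formula is the same identity in the coordinate `h g⁻¹ = (g h⁻¹)⁻¹` on `X_G`. -/
theorem mainTheorem6
    {E : Type*} [NormedAddCommGroup E] [NormedSpace ℝ E] [FiniteDimensional ℝ E]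
    {H : Type*} [TopologicalSpace H] (I : ModelWithCorners ℝ E H) [I.Boundaryless]
    (G : Type*) [TopologicalSpace G] [ChartedSpace H G] [Group G] [LieGroup I ∞ G]
    (k : ℕ) (hk : 1 ≤ k) (f : InvariantPolynomial I G k) :
    (∃! η : (Π x : G, TangentSpace I x [⋀^Fin (2 * k - 1)]→ₗ[ℝ] ℂ),
      IsChernSimonsForm (tautologicalBundle I G) f (thetaL I G) (thetaR I G) η) ∧
    (∀ x : G,
      chernSimonsForm (tautologicalBundle I G) f (thetaL I G) (thetaR I G) x =
        ((-1 : ℂ) ^ (k - 1) * (k.factorial * (k - 1).factorial) /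
          (2 ^ (k - 1) * (2 * k - 1).factorial)) • tau f x) ∧
    (∀ (x : G) (v : Fin (2 * k - 1) → TangentSpace I x),
      chernSimonsForm (tautologicalBundle I G) f (thetaL I G) (thetaR I G) x⁻¹
          (fun i => mfderiv I I (fun y : G => y⁻¹) x (v i)) =
        ((-1 : ℂ) ^ k * (k.factorial * (k - 1).factorial) /
          (2 ^ (k - 1) * (2 * k - 1).factorial)) * tau f x v) := by
  refine ⟨⟨_, isChernSimonsForm_tau hk f, fun η hη => hη.unique (isChernSimonsForm_tau hk f)⟩,
    fun x => congrFun (chernSimonsForm_tautological hk f) x, fun x v => ?_⟩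
  have hpow : (-1 : ℂ) ^ k = -(-1) ^ (k - 1) := by
    conv_lhs => rw [← Nat.sub_add_cancel hk, pow_succ]
    ring
  rw [congrFun (chernSimonsForm_tautological hk f) x⁻¹, AlternatingMap.smul_apply, tau_inv hk,
    chernSimonsConst, hpow, smul_eq_mul]
  ring
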